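/- Let $N\ge 2$ and $h>N$ be integers. Let $\Lambda_1,\dots,\Lambda_{N-1}$ be the fundamental weights of $SL(N)$, let $$P_{++}^{(h)}=\{\lambda=\lambda_1\Lambda_1+\dots+\lambda_{N-1}\Lambda_{N-1} : \lambda_i\in\mathbb Z,\ \lambda_i\ge 1,\ \lambda_1+\dots+\lambda_{N-1}<h\},$$ and let $e_1,\dots,e_N$ be the weights of the standard representation, so that $\Lambda_j=e_1+\dots+e_j$ and $(e_i,e_j)=\delta_{ij}-\frac1N$. For $\lambda\in P_{++}^{(h)}$ put $\epsilon_j(\lambda)=\exp\bigl(-\frac{2\pi i}{h}(e_j,\lambda)\bigr)$, $M(\lambda)=\mathrm{diag}(\epsilon_1(\lambda),\dots,\epsilon_N(\lambda))$, and $\gamma_p^{(\lambda)}=\chi_p(M(\lambda))$, where $\chi_p$ is the character of the $p$-th fundamental representation $\bigwedge^p\mathbb C^N$. A Zuber class II graph for $SL(N)$ at level $h-N$ consists of a finite vertex set $\mathcal V$ with an involution $a\mapsto\bar a$, a grading $\tau:\mathcal V\to\mathbb Z/N$ with $\tau(\bar a)=-\tau(a)$, and commuting $\mathcal V\times\mathcal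 V$ matrices $G_1,\dots,G_{N-1}$ with non-negative integer entries such that: - the graph with adjacency matrix $G_1$ is connected; - $(G_p)_{ab}=0$ whenever $\tau(b)\ne\tau(a)+p$; - $G_p^{t}=G_{N-p}$ and $(G_p)_{ab}=(G_p)_{\bar b\bar a}$; - the $G_p$ have a common orthonormal eigenbasis $\psi^{(\lambda,i)}$ of $\mathbb C^{\mathcal V}$, labelled by the set $\mathrm{Exp}$ of pairs $(\lambda,i)$ with $\lambda\in P_{++}^{(h)}$ and $1\le i\le m_\lambda$, with $G_p\psi^{(\lambda,i)}=\gamma_p^{(\lambda)}\psi^{(\lambda,i)}$ for all $p$, where $m_\lambda\ge 0$ is the multiplicity of the joint eigenvalue $(\gamma_p^{(\lambda)})_{1\le p\le N-1}$. For such a graph let $g=2I+\sum_{p=1}^{N-1}G_p$ be its intersection form, a real symmetric bilinear form, and for $\lambda\in P_{++}^{(h)}$ put $$q_\lambda^{(R)}=\frac1h\sum_{j=1}^{N-1}j(\lambda_j-1)+\frac{(N-h)(N-1)}{2h}.$$ **Corollary 1 (Zuber's Conjecture).** The signature of $g$ is $(x+,y-,z0)$, where, counting over $(\lambda,i)\in\mathrm{Exp}$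 (that is, each $\lambda$ with multiplicity $m_\lambda$), - $x$ is the number of those with $q_\lambda^{(R)}\in\,]2p-\frac12,2p+\frac12[$ for some $p\in\mathbb Z$; - $y$ is the number of those with $q_\lambda^{(R)}\in\,]2p+\frac12,2p+\frac32[$ for some $p\in\mathbb Z$; - $z$ is the number of those with $q_\lambda^{(R)}\in\mathbb Z+\frac12$. -/

import Mathlib

open scoped BigOperators Matrix

namespace Zuber

/-- `P_{++}^{(h)}`: the weights `l₁Λ₁ + ... + l_{N-1}Λ_{N-1}` of `SL(N)` with positive integral
coordinates and `l₁ + ... + l_{N-1} < h`. The coordinate `l_j` is stored at index `j - 1`. -/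
def Weight (N h : ℕ) : Type :=
  {l : Fin (N - 1) → ℕ // (∀ j, 0 < l j) ∧ ∑ j, l j < h}

instance Weight.instFinite (N h : ℕ) : Finite (Weight N h) := by
  have hlt : ∀ (l : Weight N h) (j : Fin (N - 1)), l.1 j < h := fun l j =>
    lt_of_le_of_lt (Finset.single_le_sum (fun _ _ => Nat.zero_le _) (Finset.mem_univ j)) l.2.2
  refine Finite.of_injective
    (fun (l : Weight N h) (j : Fin (N - 1)) => (⟨l.1 j, hlt l j⟩ : Fin h)) ?_
  intro l m hlm
  apply Subtype.ext
  funext j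
  have := congrFun hlm j
  simpa using this

noncomputable instance Weight.instFintype (N h : ℕ) : Fintype (Weight N h) :=
  Fintype.ofFinite _

/-- The scalar product `(e_i, e_k) = δ_{ik} - 1/N` of the weights `e_1, ..., e_N` of the
standard representation of `SL(N)` (with indices shifted to start at `0`). -/
noncomputable def stdInner {N : ℕ} (i k : Fin N) : ℝ :=
  (if i = k then 1 else 0) - 1 / (N : ℝ)

/-- The scalar product `(e_i, Λ_{j+1})`, where `Λ_{j+1} = e_1 + ... + e_{j+1}` is a
fundamental weight. -/
noncomputable def fundInner {N : ℕ} (i : Fin N) (j : Fin (N - 1)) : ℝ :=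
  ∑ k : Fin N with k.val ≤ j.val, stdInner i k

/-- The scalar product `(e_i, l)` for a weight `l`. -/
noncomputable def pairing {N h : ℕ} (i : Fin N) (l : Weight N h) : ℝ :=
  ∑ j, (l.1 j : ℝ) * fundInner i j

/-- `ε_i(l) = exp(-(2π𝐢/h) (e_i, l))`. -/
noncomputable def eps {N h : ℕ} (l : Weight N h) (i : Fin N) : ℂ :=
  Complex.exp (-(2 * (Real.pi : ℂ) * Complex.I / (h : ℂ)) * ((pairing i l : ℝ) : ℂ))

/-- The character of the `p`-th fundamental representation `⋀^p ℂ^N`. -/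
noncomputable def fundChar {N : ℕ} (p : ℕ) (M : Matrix (Fin N) (Fin N) ℂ) : ℂ :=
  LinearMap.trace ℂ (⋀[ℂ]^p (Fin N → ℂ)) (exteriorPower.map p (Matrix.toLin' M))

/-- `γ_p^{(l)} = χ_p(M(l))` with `M(l) = diag(ε_1(l), ..., ε_N(l))`. -/
noncomputable def gammaEig {N h : ℕ} (p : ℕ) (l : Weight N h) : ℂ :=
  fundChar p (Matrix.diagonal (eps l))

/-- The operator on `ℂ^V` of a matrix with entries in `ℕ`. -/
noncomputable def op {V : Type*} [Fintype V] [DecidableEq V] (A : Matrix V V ℕ) :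
    Module.End ℂ (EuclideanSpace ℂ V) :=
  Matrix.toEuclideanLin (A.map (Nat.cast : ℕ → ℂ))

/-- `m_l`: the dimension of the common eigenspace of `G_1, ..., G_{N-1}` on which each `G_p`
acts by `γ_p^{(l)}`. -/
noncomputable def mult {N h : ℕ} {V : Type*} [Fintype V] [DecidableEq V]
    (G : ℕ → Matrix V V ℕ) (l : Weight N h) : ℕ :=
  Module.finrank ℂ
    (⨅ p ∈ Finset.Ico 1 N, Module.End.eigenspace (op (G p)) (gammaEig p l) :
      Submodule ℂ (EuclideanSpace ℂ V))

/-- The index set `Exp` of pairs `(l, i)`, where `i` runs over `m_l` values. -/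
abbrev Exponents (N h : ℕ) {V : Type*} [Fintype V] [DecidableEq V]
    (G : ℕ → Matrix V V ℕ) : Type :=
  Σ l : Weight N h, Fin (mult G l)

/-- Class II graphs for `SL(N)` at level `h - N`, with vertex set `V`. Only the matrices
`G p` with `1 ≤ p ≤ N - 1` are meaningful. -/
structure ClassIIGraph (N h : ℕ) (V : Type*) [Fintype V] [DecidableEq V] where
  /-- the involution `a ↦ ā` -/
  bar : V → V
  /-- the `ℤ/N`-grading -/
  tau : V → ZMod N
  /-- the adjacency matrices `G_1, ..., G_{N-1}` -/
  G : ℕ → Matrix V V ℕ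
  bar_involutive : Function.Involutive bar
  tau_bar : ∀ a, tau (bar a) = -tau a
  commute : ∀ p ∈ Finset.Ico 1 N, ∀ q ∈ Finset.Ico 1 N, G p * G q = G q * G p
  connected : (SimpleGraph.fromRel fun a b => G 1 a b ≠ 0).Connected
  grading : ∀ p ∈ Finset.Ico 1 N, ∀ a b, tau b ≠ tau a + (p : ZMod N) → G p a b = 0
  transpose_eq : ∀ p ∈ Finset.Ico 1 N, (G p)ᵀ = G (N - p)
  bar_symm : ∀ p ∈ Finset.Ico 1 N, ∀ a b, G p a b = G p (bar b) (bar a)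
  /-- a common orthonormal eigenbasis labelled by `Exp` -/
  exists_eigenbasis : ∃ psi : OrthonormalBasis (Exponents N h G) ℂ (EuclideanSpace ℂ V),
    ∀ e : Exponents N h G, ∀ p ∈ Finset.Ico 1 N, op (G p) (psi e) = gammaEig p e.1 • psi e

namespace ClassIIGraph

variable {N h : ℕ} {V : Type*} [Fintype V] [DecidableEq V]

/-- The index set `Exp` of the graph. -/
abbrev Exp (Γ : ClassIIGraph N h V) : Type := Exponents N h Γ.G

/-- The matrix `g_{ab} = 2δ_{ab} + ∑_{p=1}^{N-1} (G_p)_{ab}`. -/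
def gMatrix (Γ : ClassIIGraph N h V) : Matrix V V ℝ :=
  2 • (1 : Matrix V V ℝ) + ∑ p ∈ Finset.Ico 1 N, (Γ.G p).map (Nat.cast : ℕ → ℝ)

theorem gMatrix_isSymm (Γ : ClassIIGraph N h V) : Γ.gMatrix.IsSymm := by
  have key : (∑ p ∈ Finset.Ico 1 N, (Γ.G p).map (Nat.cast : ℕ → ℝ))ᵀ
      = ∑ p ∈ Finset.Ico 1 N, (Γ.G p).map (Nat.cast : ℕ → ℝ) := by
    rw [Matrix.transpose_sum]
    refine Finset.sum_nbij' (fun p => N - p) (fun p => N - p) ?_ ?_ ?_ ?_ ?_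
    · intro p hp; simp only [Finset.mem_Ico] at hp ⊢; omega
    · intro p hp; simp only [Finset.mem_Ico] at hp ⊢; omega
    · intro p hp; simp only [Finset.mem_Ico] at hp; omega
    · intro p hp; simp only [Finset.mem_Ico] at hp; omega
    · intro p hp
      rw [← Γ.transpose_eq p hp, Matrix.transpose_map]
  unfold gMatrix Matrix.IsSymm
  rw [Matrix.transpose_add, key, Matrix.transpose_smul, Matrix.transpose_one]

/-- The intersection form `⟨α_a, α_b⟩ = g_{ab}` on the space with basis `(α_a)`, a symmetric
bilinear form. -/
noncomputable def intersectionForm (Γ : ClassIIGraph N h V) : LinearMap.BilinForm ℝ (V → ℝ) :=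
  Matrix.toBilin' Γ.gMatrix

end ClassIIGraph

/-- The signature of the symmetric bilinear form `B` is `(x+, y-, z0)`: `x` (resp. `y`) is the
maximal dimension of a subspace on which `B` is positive (resp. negative) definite, and `z` is
the dimension of the radical. -/
def HasSignature {E : Type*} [AddCommGroup E] [Module ℝ E]
    (B : LinearMap.BilinForm ℝ E) (x y z : ℕ) : Prop :=
  sigPos B.toQuadraticMap = x ∧ sigNeg B.toQuadraticMap = y ∧
    Module.finrank ℝ (LinearMap.ker B) = z

/-- `q_l^{(R)} = (1/h) ∑_{j=1}^{N-1} j (l_j - 1) + (N - h)(N - 1) / (2h)`. -/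
noncomputable def qR {N h : ℕ} (l : Weight N h) : ℝ :=
  1 / (h : ℝ) * ∑ j : Fin (N - 1), ((j.val : ℝ) + 1) * ((l.1 j : ℝ) - 1)
    + ((N : ℝ) - (h : ℝ)) * ((N : ℝ) - 1) / (2 * (h : ℝ))

end Zuber

/-!
On the eigenvector labelled by `l` the intersection form has the eigenvalue
`2 + ∑ γ_p = ∏ (1 + ε_i) = 2 ^ N ∏ cos (π (e_i, l) / h)`.

The cyclic rotation `ρ` of the `N` affine labels of a weight preserves multiplicities: conjugating
`G_p` by the diagonal operator of the `ℤ/N`-grading multiplies `γ_p` by the same root of unity as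
`ρ` does. The sequence `w_k(l) = q(ρ^k l) + k` is strictly increasing with `w_{k+N} = w_k + N`, and
the eigenvalue is `2 ^ N ∏ sin (π (w_k - 1/2) / N)` over one period. Hence it vanishes iff some
`w_e` equals `1/2`, and it has the sign `(-1) ^ e` if `w_e < 1/2 < w_{e+1}`.

The sign of a single eigenvalue need not be that of `cos (π q)`, but the counts agree: the number of
exponents with `w_e < 1/2 < w_{e+1}` is `#{w_e < 1/2} - #{w_{e+1} ≤ 1/2}`, which by invariance under
`ρ` equals `#{q + e < 1/2} - #{q + e + 1 ≤ 1/2}`, the number of exponents with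
`q + e < 1/2 < q + e + 1`.
-/

namespace Zuber

section Counting

variable {X : Type*} {ρ : Equiv.Perm X} {w : X → ℤ → ℝ}

theorem apply_zpow_of_shift (hρ : ∀ x j, w (ρ x) j = w x (j + 1) - 1) (e : ℤ) :
    ∀ x j, w ((ρ ^ e) x) j = w x (j + e) - e := by
  induction e with
  | zero => simp
  | succ n ih =>
    intro x j
    rw [zpow_add_one, Equiv.Perm.mul_apply, ih, hρ, add_assoc]
    push_cast
    ring
  | pred n ih =>
    intro x j
    have h := hρ (ρ.symm x) (j + (-n - 1))
    rw [Equiv.apply_symm_apply, add_assoc, sub_add_cancel] at h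
    rw [zpow_sub_one, Equiv.Perm.mul_apply, ih, Equiv.Perm.coe_inv, h]
    push_cast
    ring

theorem ncard_setOf_shift (hρ : ∀ x j, w (ρ x) j = w x (j + 1) - 1) (e : ℤ) (p : ℝ → Prop) :
    {x | p (w x e)}.ncard = {x | p (w x 0 + e)}.ncard := by
  rw [← Set.ncard_image_of_injective _ (ρ ^ e).injective, (ρ ^ e).image_eq_preimage_symm]
  congr 1
  ext x
  have h := apply_zpow_of_shift hρ e ((ρ ^ e).symm x) 0
  rw [Equiv.apply_symm_apply, zero_add] at h
  simp [h]

theorem ncard_setOf_mem_Ioo_shift [Finite X] (hw : ∀ x, StrictMono (w x))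
    (hρ : ∀ x j, w (ρ x) j = w x (j + 1) - 1) (t : ℝ) (e : ℤ) :
    {x | t ∈ Set.Ioo (w x e) (w x (e + 1))}.ncard =
      {x | t ∈ Set.Ioo (w x 0 + e) (w x 0 + (e + 1 : ℤ))}.ncard := by
  have ncard_eq_sub : ∀ a b : X → ℝ, (∀ x, a x < b x) → {x | t ∈ Set.Ioo (a x) (b x)}.ncard =
      {x | a x < t}.ncard - {x | b x ≤ t}.ncard := by
    intro a b hab
    rw [← Set.ncard_sdiff (s := {x | b x ≤ t}) (t := {x | a x < t})
      fun x hx => (hab x).trans_le hx]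
    congr 1
    ext x
    simp
  rw [ncard_eq_sub _ _ fun x => hw x (lt_add_one e), ncard_eq_sub _ _ fun x => by simp,
    ncard_setOf_shift hρ e (· < t), ncard_setOf_shift hρ (e + 1) (· ≤ t)]

theorem ncard_iUnion_congr [Finite X] {ι : Type*} {s t : ι → Set X}
    (hs : Pairwise (Function.onFun Disjoint s)) (ht : Pairwise (Function.onFun Disjoint t))
    (h : ∀ i, (s i).ncard = (t i).ncard) : (⋃ i, s i).ncard = (⋃ i, t i).ncard :=
  Nat.card_congr <| (Set.unionEqSigmaOfDisjoint hs).trans <|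
    (Equiv.sigmaCongrRight fun i => (Finite.card_eq.mp (h i)).some).trans
      (Set.unionEqSigmaOfDisjoint ht).symm

theorem pairwise_disjoint_setOf_mem_Ioo {v : X → ℤ → ℝ} (hv : ∀ x, Monotone (v x)) (t : ℝ)
    (S : Set ℤ) : Pairwise (Function.onFun Disjoint
      fun e : S => {x | t ∈ Set.Ioo (v x e) (v x (e + 1))}) := by
  intro d e hde
  refine Set.disjoint_left.mpr fun x hd he => ?_
  exact Set.disjoint_left.mp
    ((hv x).pairwise_disjoint_on_Ioo_succ (Subtype.coe_injective.ne hde)) hd he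

theorem ncard_setOf_exists_mem_Ioo_shift [Finite X] (hw : ∀ x, StrictMono (w x))
    (hρ : ∀ x j, w (ρ x) j = w x (j + 1) - 1) (t : ℝ) (S : Set ℤ) :
    {x | ∃ e ∈ S, t ∈ Set.Ioo (w x e) (w x (e + 1))}.ncard =
      {x | ∃ e ∈ S, t ∈ Set.Ioo (w x 0 + e) (w x 0 + (e + 1 : ℤ))}.ncard := by
  have h := ncard_iUnion_congr (pairwise_disjoint_setOf_mem_Ioo (fun x => (hw x).monotone) t S)
    (pairwise_disjoint_setOf_mem_Ioo (v := fun x e => w x 0 + e)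
      (fun x => Int.cast_mono.const_add _) t S)
    fun e => ncard_setOf_mem_Ioo_shift hw hρ t e
  simpa only [← Set.ofPred_exists, Subtype.exists, exists_prop] using h

theorem ncard_setOf_exists_eq_shift [Finite X] (hw : ∀ x, Function.Injective (w x))
    (hρ : ∀ x j, w (ρ x) j = w x (j + 1) - 1) (t : ℝ) :
    {x | ∃ e, w x e = t}.ncard = {x | ∃ e : ℤ, w x 0 + e = t}.ncard := by
  have disj : ∀ v : X → ℤ → ℝ, (∀ x, Function.Injective (v x)) →
      Pairwise (Function.onFun Disjoint fun e => {x | v x e = t}) := fun v hv d e hde =>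
    Set.disjoint_left.mpr fun x hd he => hde (hv x (hd.trans he.symm))
  have h := ncard_iUnion_congr (disj w hw)
    (disj (fun x e => w x 0 + e) fun x => (add_right_injective _).comp Int.cast_injective)
    fun e => ncard_setOf_shift hρ e (· = t)
  simpa only [← Set.ofPred_exists] using h

end Counting

section Signs

variable {N : ℕ}

theorem prod_range_add_of_antiperiodic {R : Type*} [Field R] {f : ℤ → R} [NeZero N]
    (hf : Function.Antiperiodic f N) (a : ℤ) :
    ∏ i ∈ Finset.range N, f (a + i) = (-1) ^ a * ∏ i ∈ Finset.range N, f i := by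
  have succ : ∀ b : ℤ,
      ∏ i ∈ Finset.range N, f (b + 1 + i) = -∏ i ∈ Finset.range N, f (b + i) := by
    intro b
    obtain ⟨M, rfl⟩ := Nat.exists_eq_succ_of_ne_zero (NeZero.ne N)
    rw [Finset.prod_range_succ, Finset.prod_range_succ' (fun i : ℕ => f (b + i)),
      show b + 1 + (M : ℤ) = b + (M.succ : ℕ) by push_cast; ring, hf b]
    simp [add_assoc, add_comm (1 : ℤ)]
  induction a with
  | zero => simp
  | succ n ih => rw [succ, ih, zpow_add_one₀ (by simp)]; ring
  | pred n ih =>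
    rw [← neg_eq_iff_eq_neg.mpr (succ (-n - 1)), sub_add_cancel, ih, zpow_sub_one₀ (by simp)]
    ring

variable {w : ℤ → ℝ}

theorem apply_add_mul_of_quasiperiodic (hN : ∀ j, w (j + N) = w j + N) (j m : ℤ) :
    w (j + m * N) = w j + m * N := by
  have hper : Function.Periodic (fun j => w j - j) (N : ℤ) := fun j => by simp [hN]
  have h := hper.int_mul m j
  push_cast at h
  linarith

theorem exists_mem_Ico_of_quasiperiodic [NeZero N] (hw : StrictMono w)
    (hN : ∀ j, w (j + N) = w j + N) (t : ℝ) : ∃ e, t ∈ Set.Ico (w e) (w (e + 1)) := by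
  have hN0 : (0 : ℝ) < N := by exact_mod_cast NeZero.pos N
  have lower : w (0 + ⌊(t - w 0) / N⌋ * N) ≤ t := by
    rw [apply_add_mul_of_quasiperiodic hN]
    linarith [(le_div_iff₀ hN0).mp (Int.floor_le ((t - w 0) / N))]
  have upper : t < w (0 + (⌊(t - w 0) / N⌋ + 1 : ℤ) * N) := by
    rw [apply_add_mul_of_quasiperiodic hN, Int.cast_add, Int.cast_one]
    linarith [(div_lt_iff₀ hN0).mp (Int.lt_floor_add_one ((t - w 0) / N))]
  obtain ⟨e, he, hmax⟩ := Int.exists_greatest_of_bdd (P := fun e => w e ≤ t)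
    ⟨_, fun e he => (hw.lt_iff_lt.mp (he.trans_lt upper)).le⟩ ⟨_, lower⟩
  exact ⟨e, he, not_le.mp fun h => absurd (hmax _ h) (by lia)⟩

/-- The product of the sines of `π (w j - t) / N` over one period `1 ≤ j ≤ N` of a sequence `w`
with `w (j + N) = w j + N`. Its sign records the position of `t` relative to the sequence. -/
noncomputable def sineProd (N : ℕ) (w : ℤ → ℝ) (t : ℝ) : ℝ :=
  ∏ i ∈ Finset.range N, Real.sin (Real.pi * (w (i + 1) - t) / N)

variable [NeZero N] {t : ℝ} {e : ℤ}

theorem prod_sin_eq_neg_one_zpow_mul_sineProd (hN : ∀ j, w (j + N) = w j + N) (t : ℝ) (e : ℤ) :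
    ∏ i ∈ Finset.range N, Real.sin (Real.pi * (w (e + i + 1) - t) / N) =
      (-1) ^ e * sineProd N w t := by
  refine prod_range_add_of_antiperiodic
    (f := fun j => Real.sin (Real.pi * (w (j + 1) - t) / N)) (fun j => ?_) e
  have hN0 : (N : ℝ) ≠ 0 := NeZero.ne _
  beta_reduce
  rw [add_right_comm, hN, ← Real.sin_add_pi]
  congr 1
  field_simp
  ring

theorem neg_one_zpow_mul_sineProd_pos (hw : StrictMono w) (hN : ∀ j, w (j + N) = w j + N)
    (he : t ∈ Set.Ioo (w e) (w (e + 1))) : 0 < (-1) ^ e * sineProd N w t := by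
  have hN0 : (0 : ℝ) < N := by exact_mod_cast NeZero.pos N
  rw [← prod_sin_eq_neg_one_zpow_mul_sineProd hN]
  refine Finset.prod_pos fun i hi => Real.sin_pos_of_pos_of_lt_pi ?_ ?_
  · have : w (e + 1) ≤ w (e + i + 1) := hw.monotone (by lia)
    have : 0 < w (e + i + 1) - t := by linarith [he.2]
    positivity
  · have : w (e + i + 1) ≤ w e + N := hN e ▸ hw.monotone (by have := Finset.mem_range.mp hi; lia)
    rw [div_lt_iff₀ hN0]
    exact mul_lt_mul_of_pos_left (by linarith [he.1]) Real.pi_pos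

theorem sineProd_eq_zero (hN : ∀ j, w (j + N) = w j + N) (he : w e = t) :
    sineProd N w t = 0 := by
  have h := prod_sin_eq_neg_one_zpow_mul_sineProd hN t (e - 1)
  rw [Finset.prod_eq_zero (Finset.mem_range.mpr (NeZero.pos N)) (by simp [he]), eq_comm,
    mul_eq_zero] at h
  exact h.resolve_left (zpow_ne_zero _ (by simp))

theorem sineProd_pos_of_even (hw : StrictMono w) (hN : ∀ j, w (j + N) = w j + N)
    (hev : Even e) (he : t ∈ Set.Ioo (w e) (w (e + 1))) : 0 < sineProd N w t := by
  simpa [hev.neg_one_zpow] using neg_one_zpow_mul_sineProd_pos hw hN he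

theorem sineProd_neg_of_odd (hw : StrictMono w) (hN : ∀ j, w (j + N) = w j + N)
    (hodd : Odd e) (he : t ∈ Set.Ioo (w e) (w (e + 1))) : sineProd N w t < 0 := by
  simpa [hodd.neg_one_zpow] using neg_one_zpow_mul_sineProd_pos hw hN he

theorem sineProd_trichotomy (hw : StrictMono w) (hN : ∀ j, w (j + N) = w j + N) (t : ℝ) :
    (0 < sineProd N w t ∧ ∃ e ∈ {e | Even e}, t ∈ Set.Ioo (w e) (w (e + 1))) ∨
    (sineProd N w t < 0 ∧ ∃ e ∈ {e | Odd e}, t ∈ Set.Ioo (w e) (w (e + 1))) ∨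
    (sineProd N w t = 0 ∧ ∃ e, w e = t) := by
  obtain ⟨e, hle, hlt⟩ := exists_mem_Ico_of_quasiperiodic hw hN t
  rcases hle.eq_or_lt with heq | hlt'
  · exact .inr (.inr ⟨sineProd_eq_zero hN heq, e, heq⟩)
  · rcases e.even_or_odd with hev | hodd
    · exact .inl ⟨sineProd_pos_of_even hw hN hev ⟨hlt', hlt⟩, e, hev, hlt', hlt⟩
    · exact .inr (.inl ⟨sineProd_neg_of_odd hw hN hodd ⟨hlt', hlt⟩, e, hodd, hlt', hlt⟩)

theorem sineProd_pos_iff (hw : StrictMono w) (hN : ∀ j, w (j + N) = w j + N) :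
    0 < sineProd N w t ↔ ∃ e ∈ {e | Even e}, t ∈ Set.Ioo (w e) (w (e + 1)) := by
  refine ⟨fun h => ?_, fun ⟨e, hev, he⟩ => sineProd_pos_of_even hw hN hev he⟩
  rcases sineProd_trichotomy hw hN t with h' | h' | h'
  exacts [h'.2, absurd h h'.1.not_gt, absurd h'.1 h.ne']

theorem sineProd_neg_iff (hw : StrictMono w) (hN : ∀ j, w (j + N) = w j + N) :
    sineProd N w t < 0 ↔ ∃ e ∈ {e | Odd e}, t ∈ Set.Ioo (w e) (w (e + 1)) := by
  refine ⟨fun h => ?_, fun ⟨e, hodd, he⟩ => sineProd_neg_of_odd hw hN hodd he⟩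
  rcases sineProd_trichotomy hw hN t with h' | h' | h'
  exacts [absurd h h'.1.not_gt, h'.2, absurd h'.1 h.ne]

theorem sineProd_eq_zero_iff (hw : StrictMono w) (hN : ∀ j, w (j + N) = w j + N) :
    sineProd N w t = 0 ↔ ∃ e, w e = t := by
  refine ⟨fun h => ?_, fun ⟨e, he⟩ => sineProd_eq_zero hN he⟩
  rcases sineProd_trichotomy hw hN t with h' | h' | h'
  exacts [absurd h h'.1.ne', absurd h h'.1.ne, h'.2]

end Signs

section Weights

variable {N h : ℕ}

theorem fundInner_eq (i : Fin N) (j : Fin (N - 1)) :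
    fundInner i j = (if (i : ℕ) ≤ j then 1 else 0) - ((j : ℝ) + 1) / N := by
  have hcard : (Finset.univ.filter fun k : Fin N => k.val ≤ j.val).card = j.val + 1 := by
    have := Fin.card_filter_val_lt (n := N) (m := j.val + 1)
    simp only [Nat.lt_succ_iff] at this
    lia
  simp only [fundInner, stdInner, Finset.sum_sub_distrib, Finset.sum_ite_eq, Finset.sum_const,
    hcard, Finset.mem_filter, Finset.mem_univ, true_and, nsmul_eq_mul]
  push_cast
  ring

theorem Weight.level_pos (l : Weight N h) : 0 < h := (Nat.zero_le _).trans_lt l.2.2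

/-- The labels `l₁, ..., l_{N-1}, l₀ = h - ∑ l_j` of the affine weight of level `h` attached to
a weight `l`, indexed cyclically: `l_j` is the label at `j - 1`, hence `l₀` the label at `-1`. -/
def affineLabel (l : Weight N h) (i : ZMod N) : ℕ :=
  if hi : i.val < N - 1 then l.1 ⟨i.val, hi⟩ else h - ∑ j, l.1 j

theorem affineLabel_pos (l : Weight N h) (i : ZMod N) : 0 < affineLabel l i := by
  unfold affineLabel
  split_ifs with hi
  · exact l.2.1 _
  · exact Nat.sub_pos_of_lt l.2.2

theorem affineLabel_natCast (l : Weight N h) (j : Fin (N - 1)) :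
    affineLabel l ((j : ℕ) : ZMod N) = l.1 j := by
  have hj : ((j : ℕ) : ZMod N).val = j := ZMod.val_natCast_of_lt (by lia)
  simp [affineLabel, hj]

theorem val_natCast_sub_natCast {i j : ℕ} (hi : i < N) (hj : j < N) :
    ((j : ZMod N) - i).val + (if i ≤ j then N else 0) + i = j + N := by
  split_ifs with hij
  · rw [← Nat.cast_sub hij, ZMod.val_natCast_of_lt (by lia)]
    lia
  · have : (j : ZMod N) - i = (j + N - i : ℕ) := by push_cast [show i ≤ j + N by lia]; simp
    rw [this, ZMod.val_natCast_of_lt (by lia)]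
    lia

theorem sum_fin_val_add_one (M : ℕ) : ∑ j : Fin M, ((j : ℝ) + 1) = M * (M + 1) / 2 := by
  induction M with
  | zero => simp
  | succ M ih =>
    simp only [Fin.sum_univ_castSucc, Fin.val_castSucc, Fin.val_last, ih]
    push_cast
    ring

variable [NeZero N]

theorem val_neg_one_eq_pred : (-1 : ZMod N).val = N - 1 := by
  obtain ⟨M, rfl⟩ := Nat.exists_eq_succ_of_ne_zero (NeZero.ne N)
  exact ZMod.val_neg_one M

theorem affineLabel_neg_one (l : Weight N h) : affineLabel l (-1) = h - ∑ j, l.1 j := by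
  simp [affineLabel, val_neg_one_eq_pred]

theorem sum_zmod_eq_sum_fin_pred_add {R : Type*} [AddCommMonoid R] (f : ZMod N → R) :
    ∑ j, f j = ∑ j : Fin (N - 1), f (j : ℕ) + f (-1) := by
  obtain ⟨M, rfl⟩ := Nat.exists_eq_succ_of_ne_zero (NeZero.ne N)
  have last : (-1 : ZMod (M + 1)) = Fin.last M := ZMod.val_injective _ (ZMod.val_neg_one M)
  rw [last]
  refine (Fin.sum_univ_castSucc f).trans ?_
  congr! with j
  exact congrArg f (ZMod.natCast_zmod_val (n := M + 1) j.castSucc).symm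

theorem eq_neg_one_of_pred_le_val {i : ZMod N} (hi : N - 1 ≤ i.val) : i = -1 :=
  ZMod.val_injective _ <| by rw [val_neg_one_eq_pred]; have := i.val_lt; lia

theorem sum_affineLabel (l : Weight N h) : ∑ i, affineLabel l i = h := by
  rw [sum_zmod_eq_sum_fin_pred_add, affineLabel_neg_one]
  simp only [affineLabel_natCast]
  exact Nat.add_sub_cancel' l.2.2.le

/-- Weights correspond to cyclic sequences of `N` positive labels with sum `h`. -/
def affineLabelEquiv :
    Weight N h ≃ {a : ZMod N → ℕ // (∀ i, 0 < a i) ∧ ∑ i, a i = h} where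
  toFun l := ⟨affineLabel l, affineLabel_pos l, sum_affineLabel l⟩
  invFun a := ⟨fun j => a.1 (j : ℕ), fun _ => a.2.1 _, by
    have := a.2.1 (-1)
    have := (sum_zmod_eq_sum_fin_pred_add a.1).symm.trans a.2.2
    lia⟩
  left_inv l := Subtype.ext <| funext fun j => affineLabel_natCast l j
  right_inv a := Subtype.ext <| funext fun i => by
    have hsum := (sum_zmod_eq_sum_fin_pred_add a.1).symm.trans a.2.2
    by_cases hi : i.val < N - 1
    · simp [affineLabel, hi]
    · obtain rfl := eq_neg_one_of_pred_le_val (not_lt.mp hi)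
      exact (affineLabel_neg_one _).trans (Nat.sub_eq_of_eq_add' hsum.symm)

/-- The cyclic rotation of the affine labels, as a permutation of the weights. -/
def rot : Equiv.Perm (Weight N h) :=
  affineLabelEquiv.symm.permCongr <|
    ((Equiv.addRight (1 : ZMod N)).symm.arrowCongr (Equiv.refl ℕ)).subtypeEquiv fun a =>
      and_congr ((Equiv.addRight (1 : ZMod N)).forall_congr_right (q := fun i => 0 < a i)).symm
        (Eq.congr_left (Equiv.sum_comp (Equiv.addRight (1 : ZMod N)) a).symm)

theorem affineLabel_rot (l : Weight N h) (i : ZMod N) :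
    affineLabel (rot l) i = affineLabel l (i + 1) :=
  congrFun (congrArg Subtype.val (affineLabelEquiv.apply_symm_apply _)) i

theorem val_sub_one_add_one (x : ZMod N) : (x - 1).val + 1 = x.val + if x = 0 then N else 0 := by
  have := NeZero.pos N
  split_ifs with hx
  · rw [hx, zero_sub, val_neg_one_eq_pred, ZMod.val_zero]
    lia
  · have hx0 : x.val ≠ 0 := by rwa [Ne, ZMod.val_eq_zero]
    have h1 : (1 : ZMod N).val ≤ x.val := by
      rw [ZMod.val_one_eq_one_mod]
      exact (Nat.mod_le 1 N).trans (Nat.one_le_iff_ne_zero.mpr hx0)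
    rw [ZMod.val_sub h1, ZMod.val_one_eq_one_mod, Nat.mod_eq_of_lt (by have := x.val_lt; lia)]
    lia

/-- The moment of the affine labels about the cyclic position `i`. Both `pairing i l` and `qR l`
are affine functions of such moments. -/
def labelMoment (l : Weight N h) (i : ZMod N) : ℕ :=
  ∑ j : ZMod N, affineLabel l j * (j - i).val

theorem labelMoment_rot (l : Weight N h) (i : ZMod N) :
    labelMoment (rot l) i = labelMoment l (i + 1) := by
  rw [labelMoment, labelMoment, ← Equiv.sum_comp (Equiv.addRight (1 : ZMod N))
    fun j => affineLabel l j * (j - (i + 1)).val]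
  simp [affineLabel_rot]

theorem labelMoment_add_one (l : Weight N h) (i : ZMod N) :
    labelMoment l (i + 1) + h = labelMoment l i + N * affineLabel l i := by
  calc labelMoment l (i + 1) + h
      = ∑ j, affineLabel l j * ((j - i - 1).val + 1) := by
        simp_rw [mul_add, Finset.sum_add_distrib, mul_one, sum_affineLabel, sub_sub, labelMoment]
    _ = ∑ j, affineLabel l j * ((j - i).val + if j = i then N else 0) := by
        simp_rw [val_sub_one_add_one, sub_eq_zero]
    _ = labelMoment l i + N * affineLabel l i := by
        simp [mul_add, Finset.sum_add_distrib, labelMoment, mul_comm N]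

theorem mul_pairing (l : Weight N h) (i : Fin N) :
    (N : ℝ) * pairing i l = (N - 1 - i) * h - labelMoment l (i : ℕ) := by
  have hN : (N : ℝ) ≠ 0 := NeZero.ne _
  have coeff : ∀ j < N, N - 1 - (i : ℝ) - ((j : ZMod N) - (i : ℕ)).val =
      N * (if (i : ℕ) ≤ j then 1 else 0) - (j + 1) := by
    intro j hj
    have hval := val_natCast_sub_natCast i.2 hj
    split_ifs at hval ⊢ <;> · rify at hval; linarith
  have coeff_last : N - 1 - (i : ℝ) - ((-1 : ZMod N) - (i : ℕ)).val = 0 := by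
    have last : ((N - 1 : ℕ) : ZMod N) = -1 := by
      rw [Nat.cast_pred (NeZero.pos N), ZMod.natCast_self, zero_sub]
    have hval := coeff (N - 1) (Nat.sub_one_lt (NeZero.ne N))
    rw [last, if_pos (Nat.le_sub_one_of_lt i.2), Nat.cast_pred (NeZero.pos N)] at hval
    linarith
  calc (N : ℝ) * pairing i l
      = ∑ j : Fin (N - 1), (affineLabel l (j : ℕ) : ℝ) *
          (N - 1 - i - (((j : ℕ) : ZMod N) - (i : ℕ)).val) := by
        rw [pairing, Finset.mul_sum]
        refine Finset.sum_congr rfl fun j _ => ?_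
        rw [coeff j (by lia), fundInner_eq, affineLabel_natCast]
        field_simp
    _ = ∑ j, (affineLabel l j : ℝ) * (N - 1 - i - (j - (i : ℕ)).val) := by
        rw [sum_zmod_eq_sum_fin_pred_add, coeff_last, mul_zero, add_zero]
    _ = (N - 1 - i) * h - labelMoment l (i : ℕ) := by
        simp_rw [mul_sub _ (N - 1 - i : ℝ), Finset.sum_sub_distrib, ← Finset.sum_mul]
        rw [← Nat.cast_sum, sum_affineLabel, labelMoment]
        push_cast
        ring

theorem qR_eq_labelMoment (l : Weight N h) :
    qR l = labelMoment l (-1) / h - (N - 1) / 2 := by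
  have hh : (h : ℝ) ≠ 0 := by exact_mod_cast l.level_pos.ne'
  have moment : (labelMoment l (-1) : ℝ) = ∑ j : Fin (N - 1), ((j : ℝ) + 1) * l.1 j := by
    have val : ∀ j : Fin (N - 1), (((j : ℕ) : ZMod N) - -1).val = j + 1 := fun j => by
      rw [sub_neg_eq_add, ← Nat.cast_succ, ZMod.val_natCast_of_lt (by lia)]
    simp only [labelMoment, sum_zmod_eq_sum_fin_pred_add, val, affineLabel_natCast]
    simp [mul_comm]
  have gauss : ∑ j : Fin (N - 1), ((j : ℝ) + 1) = N * (N - 1) / 2 := by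
    rw [sum_fin_val_add_one, Nat.cast_pred (NeZero.pos N)]
    ring
  rw [qR, moment]
  simp_rw [mul_sub, mul_one, Finset.sum_sub_distrib, gauss]
  field_simp
  ring

end Weights

section SpectralSequence

variable {N h : ℕ} [NeZero N]

/-- The sequence `qR (rot ^ k l) + k` attached to a weight `l`, written through label moments so
that its period and its monotonicity are visible. -/
noncomputable def spectralSeq (l : Weight N h) (k : ℤ) : ℝ :=
  labelMoment l (k - 1) / h - (N - 1) / 2 + k

theorem spectralSeq_zero (l : Weight N h) : spectralSeq l 0 = qR l := by
  simp [spectralSeq, qR_eq_labelMoment]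

theorem spectralSeq_rot (l : Weight N h) (k : ℤ) :
    spectralSeq (rot l) k = spectralSeq l (k + 1) - 1 := by
  simp only [spectralSeq, labelMoment_rot, Int.cast_add, Int.cast_one, sub_add_cancel,
    add_sub_cancel_right]
  ring

theorem spectralSeq_add_period (l : Weight N h) (k : ℤ) :
    spectralSeq l (k + N) = spectralSeq l k + N := by
  simp [spectralSeq, add_assoc]

theorem spectralSeq_add_one (l : Weight N h) (k : ℤ) :
    spectralSeq l (k + 1) = spectralSeq l k + N / h * affineLabel l (k - 1) := by
  have hh : (h : ℝ) ≠ 0 := by exact_mod_cast l.level_pos.ne'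
  have moment : (labelMoment l k : ℝ) + h = labelMoment l (k - 1) + N * affineLabel l (k - 1) := by
    exact_mod_cast sub_add_cancel (k : ZMod N) 1 ▸ labelMoment_add_one l (k - 1)
  simp only [spectralSeq, Int.cast_add, Int.cast_one, add_sub_cancel_right]
  field_simp
  linarith

theorem strictMono_spectralSeq (l : Weight N h) : StrictMono (spectralSeq l) := by
  refine strictMono_int_of_lt_succ fun k => ?_
  have hN : 0 < N := NeZero.pos N
  have hh := l.level_pos
  have ha := affineLabel_pos l (k - 1)
  rw [spectralSeq_add_one, lt_add_iff_pos_right]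
  positivity

theorem spectralSeq_natCast_add_one (l : Weight N h) (i : Fin N) :
    spectralSeq l ((i : ℕ) + 1) = (N + 1) / 2 - N / h * pairing i l := by
  have hh : (h : ℝ) ≠ 0 := by exact_mod_cast l.level_pos.ne'
  have hp := mul_pairing l i
  simp only [spectralSeq, Int.cast_add, Int.cast_natCast, Int.cast_one, add_sub_cancel_right]
  rw [div_mul_eq_mul_div, hp]
  field_simp
  ring

end SpectralSequence

section Characters

theorem trace_exteriorPower_map {R M ι : Type*} [CommRing R] [AddCommGroup M] [Module R M]
    [Fintype ι] [LinearOrder ι] (b : Module.Basis ι R M) {f : M →ₗ[R] M} {d : ι → R}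
    (hf : ∀ i, f (b i) = d i • b i) (p : ℕ) :
    LinearMap.trace R (⋀[R]^p M) (exteriorPower.map p f) =
      ∑ s ∈ Finset.powersetCard p Finset.univ, ∏ i ∈ s, d i := by
  have apply_basis (s : Set.powersetCard ι p) :
      exteriorPower.map p f (b.exteriorPower p s) = (∏ i ∈ s.1, d i) • b.exteriorPower p s := by
    rw [exteriorPower.basis_apply, exteriorPower.map_apply_ιMulti_family,
      exteriorPower.ιMulti_family, exteriorPower.ιMulti_family]
    simp only [Function.comp_def, hf]
    rw [AlternatingMap.map_smul_univ]
    congr 1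
    conv_rhs => rw [← Finset.map_orderEmbOfFin_univ s.1 s.2, Finset.prod_map]
    rfl
  rw [LinearMap.trace_eq_matrix_trace R (b.exteriorPower p), Matrix.trace,
    Finset.sum_subtype _ (p := (· ∈ Set.powersetCard ι p))
      (by simp [Set.powersetCard.mem_iff])]
  refine Finset.sum_congr rfl fun s _ => ?_
  rw [Matrix.diag_apply, LinearMap.toMatrix_apply, apply_basis]
  simp

variable {N : ℕ} (d : Fin N → ℂ)

theorem fundChar_diagonal (p : ℕ) :
    fundChar p (Matrix.diagonal d) = ∑ s ∈ Finset.powersetCard p Finset.univ, ∏ i ∈ s, d i :=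
  trace_exteriorPower_map (Pi.basisFun ℂ (Fin N)) (fun i => by simp [← Pi.single_smul]) p

theorem fundChar_diagonal_smul (p : ℕ) (c : ℂ) :
    fundChar p (Matrix.diagonal (c • d)) = c ^ p * fundChar p (Matrix.diagonal d) := by
  rw [fundChar_diagonal, fundChar_diagonal, Finset.mul_sum]
  refine Finset.sum_congr rfl fun s hs => ?_
  simp [Finset.prod_mul_distrib, (Finset.mem_powersetCard.mp hs).2]

theorem fundChar_diagonal_comp_perm (p : ℕ) (σ : Equiv.Perm (Fin N)) :
    fundChar p (Matrix.diagonal (d ∘ σ)) = fundChar p (Matrix.diagonal d) := by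
  rw [fundChar_diagonal, fundChar_diagonal]
  conv_rhs => rw [← Finset.map_univ_equiv σ, Finset.powersetCard_map, Finset.sum_map]
  simp

theorem fundChar_zero_diagonal : fundChar 0 (Matrix.diagonal d) = 1 := by
  simp [fundChar_diagonal]

theorem fundChar_self_diagonal : fundChar N (Matrix.diagonal d) = ∏ i, d i := by
  have top : Finset.powersetCard N (Finset.univ : Finset (Fin N)) = {Finset.univ} := by
    simpa using Finset.powersetCard_self (Finset.univ : Finset (Fin N))
  simp [fundChar_diagonal, top]

theorem sum_fundChar_diagonal :
    ∑ p ∈ Finset.range (N + 1), fundChar p (Matrix.diagonal d) = ∏ i, (1 + d i) := by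
  rw [Finset.prod_one_add, Finset.sum_powerset]
  simp [fundChar_diagonal]

end Characters

section Eigenvalues

theorem sum_stdInner {N : ℕ} (k : Fin N) : ∑ i, stdInner i k = 0 := by
  have : (N : ℝ) ≠ 0 := by exact_mod_cast (Fin.pos k).ne'
  simp [stdInner, this]

theorem sum_pairing {N h : ℕ} (l : Weight N h) : ∑ i, pairing i l = 0 := by
  have fund (j : Fin (N - 1)) : ∑ i : Fin N, fundInner i j = 0 := by
    simp only [fundInner]
    rw [Finset.sum_comm]
    exact Finset.sum_eq_zero fun k _ => sum_stdInner k
  simp only [pairing]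
  rw [Finset.sum_comm]
  simp [← Finset.mul_sum, fund]

theorem prod_eps {N h : ℕ} (l : Weight N h) : ∏ i, eps l i = 1 := by
  simp only [eps]
  rw [← Complex.exp_sum, ← Finset.mul_sum, ← Complex.ofReal_sum, sum_pairing]
  simp

theorem one_add_exp_neg_two_mul (x : ℝ) :
    1 + Complex.exp (-(2 * x * Complex.I)) =
      Complex.exp (-(x * Complex.I)) * (2 * Real.cos x : ℝ) := by
  push_cast
  rw [Complex.two_cos, mul_add, ← Complex.exp_add, ← Complex.exp_add, neg_add_cancel,
    Complex.exp_zero]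
  ring_nf

theorem prod_one_add_eps {N h : ℕ} (l : Weight N h) :
    ∏ i, (1 + eps l i) = (2 ^ N * ∏ i, Real.cos (Real.pi * pairing i l / h) : ℝ) := by
  have factor (i : Fin N) : 1 + eps l i =
      Complex.exp (-((Real.pi / h * pairing i l : ℝ) * Complex.I)) *
        (2 * Real.cos (Real.pi * pairing i l / h) : ℝ) := by
    rw [mul_div_right_comm, ← one_add_exp_neg_two_mul, eps]
    push_cast
    ring_nf
  simp_rw [factor]
  rw [Finset.prod_mul_distrib, ← Complex.exp_sum, Finset.sum_neg_distrib, ← Finset.sum_mul,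
    ← Complex.ofReal_sum, ← Finset.mul_sum, sum_pairing, ← Complex.ofReal_prod,
    Finset.prod_mul_distrib]
  simp

variable {N h : ℕ} [NeZero N]

theorem sineProd_spectralSeq (l : Weight N h) :
    sineProd N (spectralSeq l) (1 / 2) = ∏ i, Real.cos (Real.pi * pairing i l / h) := by
  have hN : (N : ℝ) ≠ 0 := NeZero.ne _
  rw [sineProd, Finset.prod_range]
  refine Finset.prod_congr rfl fun i _ => ?_
  rw [spectralSeq_natCast_add_one, ← Real.sin_pi_div_two_sub]
  congr 1
  field_simp
  ring

theorem two_add_sum_gammaEig (l : Weight N h) :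
    2 + ∑ p ∈ Finset.Ico 1 N, gammaEig p l =
      (2 ^ N * sineProd N (spectralSeq l) (1 / 2) : ℝ) := by
  rw [sineProd_spectralSeq, ← prod_one_add_eps, ← sum_fundChar_diagonal, Finset.sum_range_succ,
    Finset.range_eq_Ico, Finset.sum_eq_sum_Ico_succ_bot (NeZero.pos N), fundChar_zero_diagonal,
    fundChar_self_diagonal, prod_eps]
  simp only [gammaEig, zero_add]
  ring

theorem eps_eq_exp_spectralSeq (l : Weight N h) {i : Fin N} {k : ℤ} (hk : (k : ZMod N) = i.val) :
    eps l i =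
      Complex.exp (2 * Real.pi * Complex.I * (spectralSeq l (k + 1) - (N + 1) / 2 : ℝ) / N) := by
  have hN : (N : ℂ) ≠ 0 := NeZero.ne _
  have hh : (h : ℂ) ≠ 0 := by exact_mod_cast l.level_pos.ne'
  obtain ⟨m, rfl⟩ : ∃ m : ℤ, k = i.val + m * N := by
    obtain ⟨m, hm⟩ := (ZMod.intCast_eq_intCast_iff_dvd_sub i.val k N).mp (by simp [hk])
    exact ⟨m, by linarith⟩
  rw [add_right_comm, apply_add_mul_of_quasiperiodic (spectralSeq_add_period l),
    spectralSeq_natCast_add_one, eps, Complex.exp_eq_exp_iff_exists_int]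
  refine ⟨-m, ?_⟩
  push_cast
  field_simp
  ring

theorem eps_rot (l : Weight N h) :
    eps (rot l) = ZMod.stdAddChar (-1 : ZMod N) • (eps l ∘ Equiv.addRight (1 : Fin N)) := by
  have hN : (N : ℂ) ≠ 0 := NeZero.ne _
  funext i
  have hchar := ZMod.stdAddChar_coe (N := N) (-1)
  push_cast at hchar
  rw [eps_eq_exp_spectralSeq (rot l) (k := i.val) (by simp), Pi.smul_apply, Function.comp_apply,
    Equiv.coe_addRight, eps_eq_exp_spectralSeq l (k := i.val + 1) (by simp [Fin.val_add]),
    spectralSeq_rot, hchar, smul_eq_mul, ← Complex.exp_add]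
  congr 1
  push_cast
  field_simp
  ring

theorem gammaEig_rot (p : ℕ) (l : Weight N h) :
    gammaEig p (rot l) = ZMod.stdAddChar (-(p : ZMod N)) * gammaEig p l := by
  rw [gammaEig, eps_rot, fundChar_diagonal_smul, fundChar_diagonal_comp_perm, gammaEig,
    ← AddChar.map_nsmul_eq_pow, nsmul_eq_mul, mul_neg_one]

end Eigenvalues

section Signature

theorem hasSignature_of_isOrthoᵢ {E ι : Type*} [AddCommGroup E] [Module ℝ E] [Finite ι]
    {B : LinearMap.BilinForm ℝ E} (hB : B.IsSymm) (v : Module.Basis ι ℝ E) (hv : B.IsOrthoᵢ v) :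
    HasSignature B {i | 0 < B (v i) (v i)}.ncard {i | B (v i) (v i) < 0}.ncard
      {i | B (v i) (v i) = 0}.ncard := by
  have := Fintype.ofFinite ι
  have assoc : QuadraticMap.associated B.toQuadraticMap = B :=
    QuadraticMap.associated_left_inverse ℝ (fun x y => hB.eq x y)
  have equiv : B.toQuadraticMap.Equivalent
      (QuadraticMap.weightedSumSquares ℝ fun i => B (v i) (v i)) := by
    have := B.toQuadraticMap.isometryEquivBasisRepr v
    rw [B.toQuadraticMap.basisRepr_eq_of_iIsOrtho v (assoc.symm ▸ hv)] at this
    exact ⟨this⟩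
  refine ⟨QuadraticForm.sigPos_of_equiv_weightedSumSquares equiv,
    QuadraticForm.sigNeg_of_equiv_weightedSumSquares equiv, ?_⟩
  rw [← QuadraticForm.finrank_radical_of_equiv_weightedSumSquares equiv,
    QuadraticMap.radical_eq_ker_associated, assoc]

variable {V : Type*} [Fintype V] [DecidableEq V] {A : Matrix V V ℝ}

theorem hasSignature_of_isHermitian (hA : A.IsHermitian) :
    HasSignature (Matrix.toBilin' A) {i | 0 < hA.eigenvalues i}.ncard
      {i | hA.eigenvalues i < 0}.ncard {i | hA.eigenvalues i = 0}.ncard := by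
  let v : Module.Basis V ℝ (V → ℝ) :=
    hA.eigenvectorBasis.toBasis.map (WithLp.linearEquiv 2 ℝ (V → ℝ))
  have coe_v (i : V) : v i = ⇑(hA.eigenvectorBasis i) := by
    simp only [v, Module.Basis.map_apply, OrthonormalBasis.coe_toBasis]
    rfl
  have apply_v (i j : V) :
      Matrix.toBilin' A (v i) (v j) = if i = j then hA.eigenvalues j else 0 := by
    have orth := orthonormal_iff_ite.mp hA.eigenvectorBasis.orthonormal j i
    rw [EuclideanSpace.inner_eq_star_dotProduct, star_trivial] at orth
    rw [Matrix.toBilin'_apply', coe_v, coe_v, hA.mulVec_eigenvectorBasis, dotProduct_smul, orth]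
    simp [eq_comm]
  have symm : (Matrix.toBilin' A).IsSymm :=
    Matrix.isSymm_toBilin'_iff_isSymm.mpr <| by
      rwa [Matrix.IsSymm, ← Matrix.conjTranspose_eq_transpose_of_trivial]
  have sig := hasSignature_of_isOrthoᵢ symm v fun i j hij => by simpa [hij] using apply_v i j
  simpa only [apply_v, if_true] using sig

open Polynomial in
theorem charpoly_eq_prod_of_eigenbasis {R M ι : Type*} [CommRing R] [AddCommGroup M] [Module R M]
    [Module.Finite R M] [Module.Free R M] [Fintype ι] (b : Module.Basis ι R M)
    {f : Module.End R M} {μ : ι → R} (hb : ∀ i, f (b i) = μ i • b i) :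
    f.charpoly = ∏ i, (X - C (μ i)) := by
  classical
  have diag : LinearMap.toMatrix b b f = Matrix.diagonal μ := by
    ext i j
    rcases eq_or_ne i j with rfl | hij
    · simp [LinearMap.toMatrix_apply, hb]
    · simp [LinearMap.toMatrix_apply, hb, hij]
  rw [← LinearMap.charpoly_toMatrix f b, diag, Matrix.charpoly_diagonal]

variable {ι : Type*} (b : Module.Basis ι ℂ (EuclideanSpace ℂ V)) {μ : ι → ℝ}

open Polynomial in
theorem map_eigenvalues_eq [Fintype ι] (hA : A.IsHermitian)
    (hb : ∀ i, Matrix.toEuclideanLin (A.map Complex.ofReal) (b i) = (μ i : ℂ) • b i) :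
    Finset.univ.val.map hA.eigenvalues = Finset.univ.val.map μ := by
  have charpoly_eq : A.charpoly = ∏ i, (X - C (μ i)) := by
    apply Polynomial.map_injective _ (algebraMap ℝ ℂ).injective
    have := charpoly_eq_prod_of_eigenbasis b hb
    rw [Matrix.toEuclideanLin_eq_toLin_orthonormal, Matrix.charpoly_toLin] at this
    rw [← Matrix.charpoly_map, Polynomial.map_prod]
    simpa using this
  have roots_eq : A.charpoly.roots = Finset.univ.val.map μ := by
    rw [charpoly_eq, ← roots_multiset_prod_X_sub_C (Finset.univ.val.map μ), Multiset.map_map]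
    rfl
  exact hA.roots_charpoly_eq_eigenvalues.symm.trans roots_eq

theorem ncard_setOf_eigenvalues [Finite ι] (hA : A.IsHermitian)
    (hb : ∀ i, Matrix.toEuclideanLin (A.map Complex.ofReal) (b i) = (μ i : ℂ) • b i)
    (P : ℝ → Prop) : {i | P (hA.eigenvalues i)}.ncard = {i | P (μ i)}.ncard := by
  classical
  have := Fintype.ofFinite ι
  have h := congrArg (Multiset.countP P) (map_eigenvalues_eq b hA hb)
  rw [Multiset.countP_map, Multiset.countP_map] at h
  rw [Set.ncard_eq_toFinset_card', Set.ncard_eq_toFinset_card', Set.toFinset_ofPred,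
    Set.toFinset_ofPred]
  exact h

theorem hasSignature_of_eigenbasis [Finite ι] (hA : A.IsSymm)
    (hb : ∀ i, Matrix.toEuclideanLin (A.map Complex.ofReal) (b i) = (μ i : ℂ) • b i) :
    HasSignature (Matrix.toBilin' A) {i | 0 < μ i}.ncard {i | μ i < 0}.ncard
      {i | μ i = 0}.ncard := by
  have hA' : A.IsHermitian := by
    rwa [Matrix.IsHermitian, Matrix.conjTranspose_eq_transpose_of_trivial]
  rw [← ncard_setOf_eigenvalues b hA' hb (0 < ·), ← ncard_setOf_eigenvalues b hA' hb (· < 0),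
    ← ncard_setOf_eigenvalues b hA' hb (· = 0)]
  exact hasSignature_of_isHermitian hA'

end Signature

section Grading

theorem op_apply {V : Type*} [Fintype V] [DecidableEq V] (A : Matrix V V ℕ)
    (x : EuclideanSpace ℂ V) (a : V) : op A x a = ∑ b, (A a b : ℂ) * x b := by
  simp [op, Matrix.mulVec, dotProduct]

variable {N h : ℕ} [NeZero N] {V : Type*} [Fintype V] [DecidableEq V]

/-- The diagonal operator of a `ℤ/N`-grading, which multiplies the coordinate at `a` by
`exp (-2π𝐢 τ(a) / N)`. -/
noncomputable def gradingEquiv (tau : V → ZMod N) :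
    EuclideanSpace ℂ V ≃ₗ[ℂ] EuclideanSpace ℂ V where
  toFun x := WithLp.toLp 2 fun a => ZMod.stdAddChar (-tau a) * x a
  invFun x := WithLp.toLp 2 fun a => ZMod.stdAddChar (tau a) * x a
  map_add' x y := by ext a; simp [mul_add]
  map_smul' c x := by ext a; simp [mul_left_comm]
  left_inv x := by ext a; simp [← mul_assoc, ← AddChar.map_add_eq_mul]
  right_inv x := by ext a; simp [← mul_assoc, ← AddChar.map_add_eq_mul]

theorem op_gradingEquiv {tau : V → ZMod N} {A : Matrix V V ℕ} {c : ZMod N}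
    (hA : ∀ a b, tau b ≠ tau a + c → A a b = 0) (x : EuclideanSpace ℂ V) :
    op A (gradingEquiv tau x) = ZMod.stdAddChar (-c) • gradingEquiv tau (op A x) := by
  ext a
  suffices ∑ b, (A a b : ℂ) * (ZMod.stdAddChar (-tau b) * x b) =
      ∑ b, ZMod.stdAddChar (-c) * (ZMod.stdAddChar (-tau a) * (A a b * x b)) by
    simpa [gradingEquiv, op_apply, Finset.mul_sum] using this
  refine Finset.sum_congr rfl fun b _ => ?_
  by_cases hb : tau b = tau a + c
  · rw [hb, neg_add, AddChar.map_add_eq_mul]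
    ring
  · simp [hA a b hb]

variable {G : ℕ → Matrix V V ℕ} {tau : V → ZMod N}

theorem mult_rot
    (hG : ∀ p ∈ Finset.Ico 1 N, ∀ a b, tau b ≠ tau a + (p : ZMod N) → G p a b = 0)
    (l : Weight N h) : mult G (rot l) = mult G l := by
  have comap_eq : (⨅ p ∈ Finset.Ico 1 N, Module.End.eigenspace (op (G p)) (gammaEig p l)) =
      (⨅ p ∈ Finset.Ico 1 N, Module.End.eigenspace (op (G p)) (gammaEig p (rot l))).comap
        (gradingEquiv tau : EuclideanSpace ℂ V →ₗ[ℂ] EuclideanSpace ℂ V) := by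
    ext x
    simp only [Submodule.mem_comap, Submodule.mem_iInf, Module.End.mem_eigenspace_iff,
      LinearEquiv.coe_coe]
    refine forall₂_congr fun p hp => ?_
    have char_ne_zero : ZMod.stdAddChar (-(p : ZMod N)) ≠ 0 :=
      (AddChar.val_isUnit _ _).ne_zero
    rw [op_gradingEquiv (hG p hp), gammaEig_rot, mul_smul,
      (smul_right_injective _ char_ne_zero).eq_iff, ← map_smul,
      (gradingEquiv tau).injective.eq_iff]
  rw [mult, mult, comap_eq, Submodule.comap_equiv_eq_map_symm, LinearEquiv.finrank_map_eq]

/-- The permutation of the exponents induced by the rotation of weights. -/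
noncomputable def rotExponents (hmult : ∀ l : Weight N h, mult G (rot l) = mult G l) :
    Equiv.Perm (Exponents N h G) :=
  rot.sigmaCongr fun l => finCongr (hmult l).symm

theorem rotExponents_fst (hmult : ∀ l : Weight N h, mult G (rot l) = mult G l)
    (e : Exponents N h G) :
    (rotExponents hmult e).1 = rot e.1 := by
  simp [rotExponents, Equiv.sigmaCongr]

theorem spectralSeq_rotExponents (hmult : ∀ l : Weight N h, mult G (rot l) = mult G l)
    (e : Exponents N h G) (k : ℤ) :
    spectralSeq (rotExponents hmult e).1 k = spectralSeq e.1 (k + 1) - 1 := by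
  rw [rotExponents_fst, spectralSeq_rot]

end Grading

section IntersectionForm

variable {N h : ℕ} {V : Type*} [Fintype V] [DecidableEq V] {G : ℕ → Matrix V V ℕ}

theorem toEuclideanLin_two_add_sum (G : ℕ → Matrix V V ℕ) (s : Finset ℕ) :
    Matrix.toEuclideanLin
        ((2 • (1 : Matrix V V ℝ) + ∑ p ∈ s, (G p).map (Nat.cast : ℕ → ℝ)).map Complex.ofReal) =
      2 • LinearMap.id + ∑ p ∈ s, op (G p) := by
  have : (2 • (1 : Matrix V V ℝ) + ∑ p ∈ s, (G p).map (Nat.cast : ℕ → ℝ)).map Complex.ofReal =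
      2 • (1 : Matrix V V ℂ) + ∑ p ∈ s, (G p).map (Nat.cast : ℕ → ℂ) := by
    ext a b
    rw [Matrix.map_apply, two_nsmul, two_nsmul]
    by_cases hab : a = b <;> simp [Matrix.sum_apply, hab]
  rw [this, map_add, map_nsmul, map_sum]
  congr 2
  ext x a
  simp

theorem hasSignature_of_exponents [NeZero N]
    (hsymm : (2 • (1 : Matrix V V ℝ) + ∑ p ∈ Finset.Ico 1 N, (G p).map Nat.cast).IsSymm)
    (psi : Module.Basis (Exponents N h G) ℂ (EuclideanSpace ℂ V))
    (hpsi : ∀ e, ∀ p ∈ Finset.Ico 1 N, op (G p) (psi e) = gammaEig p e.1 • psi e) :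
    HasSignature (Matrix.toBilin' (2 • 1 + ∑ p ∈ Finset.Ico 1 N, (G p).map Nat.cast))
      {e : Exponents N h G | 0 < sineProd N (spectralSeq e.1) (1 / 2)}.ncard
      {e : Exponents N h G | sineProd N (spectralSeq e.1) (1 / 2) < 0}.ncard
      {e : Exponents N h G | sineProd N (spectralSeq e.1) (1 / 2) = 0}.ncard := by
  have hpow : (0 : ℝ) < 2 ^ N := by positivity
  have sig := hasSignature_of_eigenbasis psi
    (μ := fun e => 2 ^ N * sineProd N (spectralSeq e.1) (1 / 2)) hsymm fun e => by
      rw [toEuclideanLin_two_add_sum, ← two_add_sum_gammaEig, LinearMap.add_apply,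
        LinearMap.sum_apply, Finset.sum_congr rfl (hpsi e), add_smul, Finset.sum_smul]
      simp [two_smul]
  simpa only [mul_pos_iff_of_pos_left hpow, mul_neg_iff, hpow, hpow.not_gt, true_and, false_and,
    or_false, mul_eq_zero, hpow.ne',
    false_or] using sig

end IntersectionForm

section Count

theorem exists_even_mem_Ioo_iff (q : ℝ) :
    (∃ e ∈ {e : ℤ | Even e}, (1 / 2 : ℝ) ∈ Set.Ioo (q + e) (q + (e + 1 : ℤ))) ↔
      ∃ p : ℤ, q ∈ Set.Ioo (2 * (p : ℝ) - 1 / 2) (2 * (p : ℝ) + 1 / 2) := by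
  constructor
  · rintro ⟨_, ⟨p, rfl⟩, hq⟩
    exact ⟨-p, by push_cast at hq ⊢; constructor <;> linarith [hq.1, hq.2]⟩
  · rintro ⟨p, hq⟩
    exact ⟨-p + -p, ⟨-p, rfl⟩, by push_cast; constructor <;> linarith [hq.1, hq.2]⟩

theorem exists_odd_mem_Ioo_iff (q : ℝ) :
    (∃ e ∈ {e : ℤ | Odd e}, (1 / 2 : ℝ) ∈ Set.Ioo (q + e) (q + (e + 1 : ℤ))) ↔
      ∃ p : ℤ, q ∈ Set.Ioo (2 * (p : ℝ) + 1 / 2) (2 * (p : ℝ) + 3 / 2) := by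
  constructor
  · rintro ⟨_, ⟨p, rfl⟩, hq⟩
    exact ⟨-p - 1, by push_cast at hq ⊢; constructor <;> linarith [hq.1, hq.2]⟩
  · rintro ⟨p, hq⟩
    exact ⟨2 * (-p - 1) + 1, ⟨-p - 1, rfl⟩, by push_cast; constructor <;> linarith [hq.1, hq.2]⟩

theorem exists_add_eq_half_iff (q : ℝ) :
    (∃ e : ℤ, q + e = 1 / 2) ↔ ∃ p : ℤ, q = (p : ℝ) + 1 / 2 :=
  (Equiv.neg ℤ).exists_congr fun e => by
    rw [Equiv.neg_apply, Int.cast_neg, neg_add_eq_sub, eq_sub_iff_add_eq]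

variable {N h : ℕ} [NeZero N] {V : Type*} [Fintype V] [DecidableEq V] {G : ℕ → Matrix V V ℕ}

theorem ncard_sineProd_pos (hmult : ∀ l : Weight N h, mult G (rot l) = mult G l) :
    {e : Exponents N h G | 0 < sineProd N (spectralSeq e.1) (1 / 2)}.ncard =
      Nat.card {e : Exponents N h G // ∃ p : ℤ,
        qR e.1 ∈ Set.Ioo (2 * (p : ℝ) - 1 / 2) (2 * (p : ℝ) + 1 / 2)} := by
  simp_rw [sineProd_pos_iff (strictMono_spectralSeq _) (spectralSeq_add_period _),
    ← exists_even_mem_Ioo_iff, ← spectralSeq_zero]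
  exact ncard_setOf_exists_mem_Ioo_shift (w := fun e : Exponents N h G => spectralSeq e.1)
    (fun e => strictMono_spectralSeq e.1) (spectralSeq_rotExponents hmult) _ _

theorem ncard_sineProd_neg (hmult : ∀ l : Weight N h, mult G (rot l) = mult G l) :
    {e : Exponents N h G | sineProd N (spectralSeq e.1) (1 / 2) < 0}.ncard =
      Nat.card {e : Exponents N h G // ∃ p : ℤ,
        qR e.1 ∈ Set.Ioo (2 * (p : ℝ) + 1 / 2) (2 * (p : ℝ) + 3 / 2)} := by
  simp_rw [sineProd_neg_iff (strictMono_spectralSeq _) (spectralSeq_add_period _),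
    ← exists_odd_mem_Ioo_iff, ← spectralSeq_zero]
  exact ncard_setOf_exists_mem_Ioo_shift (w := fun e : Exponents N h G => spectralSeq e.1)
    (fun e => strictMono_spectralSeq e.1) (spectralSeq_rotExponents hmult) _ _

theorem ncard_sineProd_eq_zero (hmult : ∀ l : Weight N h, mult G (rot l) = mult G l) :
    {e : Exponents N h G | sineProd N (spectralSeq e.1) (1 / 2) = 0}.ncard =
      Nat.card {e : Exponents N h G // ∃ p : ℤ, qR e.1 = (p : ℝ) + 1 / 2} := by
  simp_rw [sineProd_eq_zero_iff (strictMono_spectralSeq _) (spectralSeq_add_period _),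
    ← exists_add_eq_half_iff, ← spectralSeq_zero]
  exact ncard_setOf_exists_eq_shift (w := fun e : Exponents N h G => spectralSeq e.1)
    (fun e => (strictMono_spectralSeq e.1).injective) (spectralSeq_rotExponents hmult) _

end Count

theorem corollary1_general {N h : ℕ} [NeZero N] {V : Type*} [Fintype V] [DecidableEq V]
    {G : ℕ → Matrix V V ℕ}
    (hsymm : (2 • (1 : Matrix V V ℝ) + ∑ p ∈ Finset.Ico 1 N, (G p).map Nat.cast).IsSymm)
    {tau : V → ZMod N}
    (hG : ∀ p ∈ Finset.Ico 1 N, ∀ a b, tau b ≠ tau a + (p : ZMod N) → G p a b = 0)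
    (psi : Module.Basis (Exponents N h G) ℂ (EuclideanSpace ℂ V))
    (hpsi : ∀ e, ∀ p ∈ Finset.Ico 1 N, op (G p) (psi e) = gammaEig p e.1 • psi e) :
    HasSignature (Matrix.toBilin' (2 • 1 + ∑ p ∈ Finset.Ico 1 N, (G p).map Nat.cast))
      (Nat.card {e : Exponents N h G // ∃ p : ℤ,
        qR e.1 ∈ Set.Ioo (2 * (p : ℝ) - 1 / 2) (2 * (p : ℝ) + 1 / 2)})
      (Nat.card {e : Exponents N h G // ∃ p : ℤ,
        qR e.1 ∈ Set.Ioo (2 * (p : ℝ) + 1 / 2) (2 * (p : ℝ) + 3 / 2)})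
      (Nat.card {e : Exponents N h G // ∃ p : ℤ, qR e.1 = (p : ℝ) + 1 / 2}) := by
  have hmult : ∀ l : Weight N h, mult G (rot l) = mult G l := mult_rot hG
  rw [← ncard_sineProd_pos hmult, ← ncard_sineProd_neg hmult, ← ncard_sineProd_eq_zero hmult]
  exact hasSignature_of_exponents hsymm psi hpsi

end Zuber

theorem corollary1 {N h : ℕ} (hN : 2 ≤ N) (hh : N < h) {V : Type*} [Fintype V] [DecidableEq V]
    (Γ : Zuber.ClassIIGraph N h V) :
    Zuber.HasSignature Γ.intersectionForm
      (Nat.card {e : Γ.Exp // ∃ p : ℤ,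
        Zuber.qR e.1 ∈ Set.Ioo (2 * (p : ℝ) - 1 / 2) (2 * (p : ℝ) + 1 / 2)})
      (Nat.card {e : Γ.Exp // ∃ p : ℤ,
        Zuber.qR e.1 ∈ Set.Ioo (2 * (p : ℝ) + 1 / 2) (2 * (p : ℝ) + 3 / 2)})
      (Nat.card {e : Γ.Exp // ∃ p : ℤ, Zuber.qR e.1 = (p : ℝ) + 1 / 2}) := by
  have : NeZero N := ⟨by lia⟩
  obtain ⟨psi, hpsi⟩ := Γ.exists_eigenbasis
  exact Zuber.corollary1_general Γ.gMatrix_isSymm Γ.grading psi.toBasis (by simpa using hpsi)
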